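/- Theorem 8 (posterior in the deterministic limit). Let $\mathcal X\subseteq\mathbb R^D$ and $\mathcal Y\subseteq\mathbb R^d$ be open sets (coordinate domains), let $M$ be a smooth Riemannian metric on $\mathcal X$, given by positive definite symmetric matrices $M(x)$, and let $f:\mathcal Y\to\mathcal X$ be a smooth embedding (smooth, a homeomorphism onto its image, with Jacobian $J_f(y)$ of full column rank for every $y\in\mathcal Y$). Let $J_f^\top MJ_f$ denote the pull-back metric $y\mapsto J_f(y)^\top M(f(y))J_f(y)$ on $\mathcal Y$. For an open set $U\subseteq\mathbb R^n$ with a metric $g$, a point $\mu\in U$ and $\lambda>0$, let the Gaussian on $(U,g)$ be the density $$G_{U,g}(x\mid\mu,\lambda I)=\frac1Z\exp\Big(-\frac\lambda2(x-\mu)^\top g(\mu)(x-\mu)\Big),\qquad Z=\int_U\exp\Big(-\frac\lambda2(x-\mu)^\top g(\mu)(x-\mu)\Big)\,dx .$$ Assume that the geometry is uniform along $f(\mathcal Y)$: there are constants $0<c\le C$ with $c|v|^2\le v^\top M(f(y))v\le C|v|^2$ for all $y\in\mathcal Y$, $v\in\mathbb R^D$, and for every $r>0$ the Lebesgue volume of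 $\mathcal X\cap B(f(y),r)$ is bounded below by a positive constant independent of $y\in\mathcal Y$. (All this holds automatically if $f(\mathcal Y)$ is contained in a compact subset of $\mathcal X$; the volume condition also holds if $\mathcal X=\mathbb R^D$.) Let $p$ be a smooth probability density on $\mathcal Y$ (the prior), and let $p_\lambda(x\mid y)=G_{\mathcal X,M}(x\mid f(y),\lambda I)$ be the likelihood. Let $x\in f(\mathcal Y)$ with $p(f^{-1}(x))>0$. Then for every $\lambda>0$ the evidence $p_\lambda(x)=\int_{\mathcal Y}p(y)\,p_\lambda(x\mid y)\,dy$ is positive and finite, so that the Bayesian posterior density $p_\lambda(y\mid x)=p(y)\,p_\lambda(x\mid y)/p_\lambda(x)$ is well defined; and as $\lambda\to\infty$ it is asymptotically the Gaussian $G_\lambda(y)=G_{\mathcal Y,\,J_f^\top MJ_f}(y\mid f^{-1}(x),\lambda I)$, which is centred at $f^{-1}(x)$ and has precision matrix $\lambda J_f^\top M(x)J_f$ with $J_f=J_f(f^{-1}(x))$, in the following two senses: 1. $\displaystyle\lim_{\lambda\to\infty}\int_{\mathcal Y}\big|p_\lambda(y\mid x)-G_\lambda(y)\big|\,dy=0$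 (convergence in total variation); 2. for every $R>0$, $\displaystyle\lim_{\lambda\to\infty}\ \sup\Big\{\Big|\frac{p_\lambda(y\mid x)}{G_\lambda(y)}-1\Big| : y\in\mathcal Y,\ |y-f^{-1}(x)|\le R/\sqrt\lambda\Big\}=0$. -/

import Mathlib

open MeasureTheory Filter Topology
open scoped ContDiff Matrix

noncomputable section

namespace RiemGauss

/-- The squared length `vᵀ A v`. -/
def metricSq {n : ℕ} (A : Matrix (Fin n) (Fin n) ℝ) (v : EuclideanSpace ℝ (Fin n)) : ℝ :=
  v.ofLp ⬝ᵥ (A *ᵥ v.ofLp)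

/-- `M` is a smooth Riemannian metric on `X`, an open coordinate domain of `ℝⁿ`. -/
structure IsMetricOn {n : ℕ} (M : EuclideanSpace ℝ (Fin n) → Matrix (Fin n) (Fin n) ℝ)
    (X : Set (EuclideanSpace ℝ (Fin n))) : Prop where
  smooth : ∀ i j, ContDiffOn ℝ ∞ (fun x => M x i j) X
  posDef : ∀ x ∈ X, (M x).PosDef

/-- The Jacobian matrix `∂fᵢ/∂yⱼ` at `y`. -/
def jacobian {d D : ℕ} (f : EuclideanSpace ℝ (Fin d) → EuclideanSpace ℝ (Fin D))
    (y : EuclideanSpace ℝ (Fin d)) : Matrix (Fin D) (Fin d) ℝ :=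
  Matrix.of fun i j => fderiv ℝ f y (EuclideanSpace.single j 1) i

/-- `f` is a smooth embedding of `Y` into `X`: a smooth map, of full column rank everywhere,
which is a homeomorphism onto its image. -/
structure IsSmoothEmbeddingOn {d D : ℕ}
    (f : EuclideanSpace ℝ (Fin d) → EuclideanSpace ℝ (Fin D))
    (Y : Set (EuclideanSpace ℝ (Fin d))) (X : Set (EuclideanSpace ℝ (Fin D))) : Prop where
  mapsTo : Set.MapsTo f Y X
  smooth : ContDiffOn ℝ ∞ f Y
  fullRank : ∀ y ∈ Y, (jacobian f y).rank = d
  isEmbedding : IsEmbedding (Y.domRestrict f)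

/-- The pull-back metric `y ↦ J(y)ᵀ M(f(y)) J(y)`. -/
def pullbackMetric {d D : ℕ} (f : EuclideanSpace ℝ (Fin d) → EuclideanSpace ℝ (Fin D))
    (M : EuclideanSpace ℝ (Fin D) → Matrix (Fin D) (Fin D) ℝ)
    (y : EuclideanSpace ℝ (Fin d)) : Matrix (Fin d) (Fin d) ℝ :=
  (jacobian f y)ᵀ * M (f y) * jacobian f y

/-- `exp(-(lam/2) (x-μ)ᵀ M(μ) (x-μ))`. -/
def gaussKernel {n : ℕ} (M : EuclideanSpace ℝ (Fin n) → Matrix (Fin n) (Fin n) ℝ)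
    (lam : ℝ) (μ x : EuclideanSpace ℝ (Fin n)) : ℝ :=
  Real.exp (-(lam / 2) * metricSq (M μ) (x - μ))

/-- The normalizing constant `Z = ∫_X exp(-(lam/2) (x-μ)ᵀ M(μ) (x-μ)) dx`. -/
def gaussZ {n : ℕ} (X : Set (EuclideanSpace ℝ (Fin n)))
    (M : EuclideanSpace ℝ (Fin n) → Matrix (Fin n) (Fin n) ℝ)
    (lam : ℝ) (μ : EuclideanSpace ℝ (Fin n)) : ℝ :=
  ∫ x in X, gaussKernel M lam μ x

/-- The density at `x` of the Gaussian `G(· | μ, lam I)` on `X` with respect to the metric `M`. -/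
def gaussDensity {n : ℕ} (X : Set (EuclideanSpace ℝ (Fin n)))
    (M : EuclideanSpace ℝ (Fin n) → Matrix (Fin n) (Fin n) ℝ)
    (lam : ℝ) (μ x : EuclideanSpace ℝ (Fin n)) : ℝ :=
  gaussKernel M lam μ x / gaussZ X M lam μ

/-- The joint density `p(x, y) = p(y) p(x | y)` with `p(x | y) = G(x | f(y), lam I)`. -/
def jointDensity {d D : ℕ} (X : Set (EuclideanSpace ℝ (Fin D)))
    (M : EuclideanSpace ℝ (Fin D) → Matrix (Fin D) (Fin D) ℝ)
    (f : EuclideanSpace ℝ (Fin d) → EuclideanSpace ℝ (Fin D))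
    (p : EuclideanSpace ℝ (Fin d) → ℝ) (lam : ℝ)
    (x : EuclideanSpace ℝ (Fin D)) (y : EuclideanSpace ℝ (Fin d)) : ℝ :=
  p y * gaussDensity X M lam (f y) x

/-- The evidence `p(x) = ∫_Y p(x, y) dy`. -/
def evidence {d D : ℕ} (X : Set (EuclideanSpace ℝ (Fin D)))
    (M : EuclideanSpace ℝ (Fin D) → Matrix (Fin D) (Fin D) ℝ)
    (Y : Set (EuclideanSpace ℝ (Fin d)))
    (f : EuclideanSpace ℝ (Fin d) → EuclideanSpace ℝ (Fin D))
    (p : EuclideanSpace ℝ (Fin d) → ℝ) (lam : ℝ) (x : EuclideanSpace ℝ (Fin D)) : ℝ :=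
  ∫ y in Y, jointDensity X M f p lam x y

/-- The posterior density `p(y | x) = p(x, y) / p(x)` (Bayes' rule). -/
def posteriorDensity {d D : ℕ} (X : Set (EuclideanSpace ℝ (Fin D)))
    (M : EuclideanSpace ℝ (Fin D) → Matrix (Fin D) (Fin D) ℝ)
    (Y : Set (EuclideanSpace ℝ (Fin d)))
    (f : EuclideanSpace ℝ (Fin d) → EuclideanSpace ℝ (Fin D))
    (p : EuclideanSpace ℝ (Fin d) → ℝ) (lam : ℝ)
    (x : EuclideanSpace ℝ (Fin D)) (y : EuclideanSpace ℝ (Fin d)) : ℝ :=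
  jointDensity X M f p lam x y / evidence X M Y f p lam x

/-- Uniformity of the geometry of `(X, M)` along the image `f(Y)`: the metric is uniformly
comparable there with the Euclidean one, and `X` does not get arbitrarily thin. Both hold
if `f(Y)` lies in a compact subset of `X`; the second one also if `X` is all of `ℝᴰ`. -/
structure UniformAlong {d D : ℕ} (X : Set (EuclideanSpace ℝ (Fin D)))
    (M : EuclideanSpace ℝ (Fin D) → Matrix (Fin D) (Fin D) ℝ)
    (Y : Set (EuclideanSpace ℝ (Fin d)))
    (f : EuclideanSpace ℝ (Fin d) → EuclideanSpace ℝ (Fin D)) : Prop where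
  lower : ∃ c : ℝ, 0 < c ∧ ∀ y ∈ Y, ∀ v, c * ‖v‖ ^ 2 ≤ metricSq (M (f y)) v
  upper : ∃ C : ℝ, ∀ y ∈ Y, ∀ v, metricSq (M (f y)) v ≤ C * ‖v‖ ^ 2
  thick : ∀ r : ℝ, 0 < r → ∃ m : ENNReal, 0 < m ∧
    ∀ y ∈ Y, m ≤ volume (X ∩ Metric.ball (f y) r)

end RiemGauss

end

/-! A factor independent of `y` cancels in the posterior, so the joint density may be multiplied by
`√lam ^ d / √lam ^ D`. At distances of order `lam ^ (-1/2)` from `y₀` it then becomes Gaussian, for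
two reasons. The squared length of `f y₀ - f y` in the metric `M (f y)` equals the pull-back form at
`y₀` up to `o(‖y - y₀‖²)`, an error that still vanishes after multiplication by `lam`
(`metricSq_sub_pullbackMetric_isLittleO`, `tendsto_mul_scaleFilter`). And `√lam ^ D * gaussZ` at `f
y` tends to the full Gaussian integral for `M (f y₀)`, because at this scale the boundary of `X`
recedes to infinity (`tendsto_sqrt_pow_mul_gaussZ`). The prior and this integral enter the limit
only as constants, which normalization removes.

It remains to see that the local limit captures all the mass. Near `y₀`, full rank gives a Gaussian
bound and dominated convergence applies (`tendsto_integral_abs_sub_rescaled`). Away from `y₀`, the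
embedding keeps `f y` at distance at least `η` from `f y₀`, so the kernel is at most `exp (-lam * c
* η² / 2)`; uniformity bounds `gaussZ` below by a multiple of `exp (-lam * τ)` with `τ` arbitrarily
small, and the prior is integrable. Hence the rescaled joint density is `L¹`-close to the rescaled
`limitProfile`, their masses have the same positive limit, and division by the masses gives both
claims. -/

namespace RiemGauss

/-! ### Quadratic forms and their perturbation -/

section QuadraticForm

variable {n : ℕ}

theorem metricSq_smul (A : Matrix (Fin n) (Fin n) ℝ) (t : ℝ) (v : EuclideanSpace ℝ (Fin n)) :
    metricSq A (t • v) = t ^ 2 * metricSq A v := by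
  simp only [metricSq, WithLp.ofLp_smul, Matrix.mulVec_smul, smul_dotProduct, dotProduct_smul,
    smul_eq_mul]
  ring

theorem metricSq_neg (A : Matrix (Fin n) (Fin n) ℝ) (v : EuclideanSpace ℝ (Fin n)) :
    metricSq A (-v) = metricSq A v := by
  have := metricSq_smul A (-1) v
  simpa using this

theorem metricSq_sub_comm (A : Matrix (Fin n) (Fin n) ℝ) (v w : EuclideanSpace ℝ (Fin n)) :
    metricSq A (v - w) = metricSq A (w - v) := by
  rw [← metricSq_neg, neg_sub]

theorem continuous_metricSq :
    Continuous fun q : Matrix (Fin n) (Fin n) ℝ × EuclideanSpace ℝ (Fin n) =>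
      metricSq q.1 q.2 := by
  unfold metricSq
  fun_prop

theorem continuous_metricSq_right (A : Matrix (Fin n) (Fin n) ℝ) : Continuous (metricSq A) :=
  continuous_metricSq.comp (Continuous.prodMk_right A)

/-- The entrywise `ℓ¹` norm of `A` bounds the bilinear form of `A`. -/
theorem abs_dotProduct_mulVec_le (A : Matrix (Fin n) (Fin n) ℝ) (v w : EuclideanSpace ℝ (Fin n)) :
    |v.ofLp ⬝ᵥ (A *ᵥ w.ofLp)| ≤ (∑ i, ∑ j, |A i j|) * (‖v‖ * ‖w‖) := by
  simp only [dotProduct, Matrix.mulVec, Finset.mul_sum, Finset.sum_mul]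
  refine (Finset.abs_sum_le_sum_abs _ _).trans (Finset.sum_le_sum fun i _ => ?_)
  refine (Finset.abs_sum_le_sum_abs _ _).trans (Finset.sum_le_sum fun j _ => ?_)
  have hv : |v i| ≤ ‖v‖ := by simpa using PiLp.norm_apply_le v i
  have hw : |w j| ≤ ‖w‖ := by simpa using PiLp.norm_apply_le w j
  rw [abs_mul, abs_mul]
  calc |v i| * (|A i j| * |w j|) = |A i j| * (|v i| * |w j|) := by ring
    _ ≤ |A i j| * (‖v‖ * ‖w‖) := by gcongr

/-- First the matrix changes with `v` fixed, then the vector with `B` fixed. Used with `v` an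
increment of `f` and `w` its linearization. -/
theorem abs_metricSq_sub_metricSq_le (A B : Matrix (Fin n) (Fin n) ℝ)
    (v w : EuclideanSpace ℝ (Fin n)) :
    |metricSq A v - metricSq B w| ≤ (∑ i, ∑ j, |(A - B) i j|) * ‖v‖ ^ 2 +
      (∑ i, ∑ j, |B i j|) * (‖v - w‖ * (‖v‖ + ‖w‖)) := by
  have h : metricSq A v - metricSq B w = v.ofLp ⬝ᵥ ((A - B) *ᵥ v.ofLp) +
      ((v - w).ofLp ⬝ᵥ (B *ᵥ v.ofLp) + w.ofLp ⬝ᵥ (B *ᵥ (v - w).ofLp)) := by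
    simp only [metricSq, WithLp.ofLp_sub, Matrix.sub_mulVec, dotProduct_sub, sub_dotProduct,
      Matrix.mulVec_sub]
    ring
  rw [h]
  have h1 := abs_dotProduct_mulVec_le (A - B) v v
  have h2 := abs_dotProduct_mulVec_le B (v - w) v
  have h3 := abs_dotProduct_mulVec_le B w (v - w)
  refine (abs_add_le _ _).trans (add_le_add (by simpa [sq] using h1) ?_)
  refine (abs_add_le _ _).trans ((add_le_add h2 h3).trans (le_of_eq (by ring)))

theorem IsMetricOn.continuousOn {M : EuclideanSpace ℝ (Fin n) → Matrix (Fin n) (Fin n) ℝ}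
    {X : Set (EuclideanSpace ℝ (Fin n))} (hM : IsMetricOn M X) : ContinuousOn M X :=
  continuousOn_pi.2 fun i => continuousOn_pi.2 fun j => (hM.smooth i j).continuousOn

end QuadraticForm

/-! ### The Jacobian as Fréchet derivative -/

section Jacobian

variable {d D : ℕ} {f : EuclideanSpace ℝ (Fin d) → EuclideanSpace ℝ (Fin D)}
  {M : EuclideanSpace ℝ (Fin D) → Matrix (Fin D) (Fin D) ℝ} {y : EuclideanSpace ℝ (Fin d)}

theorem jacobian_mulVec (v : EuclideanSpace ℝ (Fin d)) :
    jacobian f y *ᵥ v.ofLp = (fderiv ℝ f y v).ofLp := by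
  have hv : v = ∑ j, v j • EuclideanSpace.single j (1 : ℝ) := by
    ext i
    simp [Finset.sum_apply, Pi.single_apply]
  ext i
  conv_rhs => rw [hv]
  simp [jacobian, Matrix.mulVec, dotProduct, mul_comm]

theorem metricSq_pullbackMetric (v : EuclideanSpace ℝ (Fin d)) :
    metricSq (pullbackMetric f M y) v = metricSq (M (f y)) (fderiv ℝ f y v) := by
  simp only [metricSq, pullbackMetric, ← jacobian_mulVec, ← Matrix.mulVec_mulVec,
    Matrix.dotProduct_mulVec, Matrix.vecMul_transpose]

theorem fderiv_injective_of_rank (h : (jacobian f y).rank = d) :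
    Function.Injective (fderiv ℝ f y) := by
  have hli : LinearIndependent ℝ (jacobian f y).col := by
    rw [linearIndependent_iff_card_eq_finrank_span, Set.finrank, ← Matrix.rank_eq_finrank_span_cols,
      h, Fintype.card_fin]
  have hinj := Matrix.mulVec_injective_iff.2 hli
  intro v w hvw
  apply WithLp.ofLp_injective 2
  apply hinj
  simp only [jacobian_mulVec, hvw]

theorem exists_mul_norm_le_fderiv (h : (jacobian f y).rank = d) :
    ∃ k : ℝ, 0 < k ∧ ∀ v, k * ‖v‖ ≤ ‖fderiv ℝ f y v‖ := by
  obtain ⟨K, hK0, hK⟩ := (fderiv ℝ f y).toLinearMap.exists_antilipschitzWith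
    (LinearMap.ker_eq_bot.2 (fderiv_injective_of_rank h))
  refine ⟨(K : ℝ)⁻¹, by positivity, fun v => ?_⟩
  have := hK.le_mul_norm (map_zero _) v
  rw [inv_mul_le_iff₀ (by positivity)]
  exact this

end Jacobian

/-! ### Gaussian integrals and normalizing constants -/

section GaussianIntegral

variable {n : ℕ}

theorem integrable_exp_neg_mul_norm_sq {b : ℝ} (hb : 0 < b) :
    Integrable fun v : EuclideanSpace ℝ (Fin n) => Real.exp (-b * ‖v‖ ^ 2) := by
  -- The Bochner integral of a non-integrable function is zero by convention, so a nonzero value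
  -- proves integrability.
  refine Integrable.of_integral_ne_zero ?_
  rw [GaussianFourier.integral_rexp_neg_mul_sq_norm hb]
  positivity

theorem integral_comp_add_inv_smul (F : EuclideanSpace ℝ (Fin n) → ℝ)
    (μ : EuclideanSpace ℝ (Fin n)) {s : ℝ} (hs : 0 ≤ s) :
    ∫ u, F (μ + s⁻¹ • u) = s ^ n * ∫ z, F z := by
  rw [Measure.integral_comp_inv_smul_of_nonneg volume (fun w => F (μ + w)) hs,
    integral_add_left_eq_self F μ, finrank_euclideanSpace_fin, smul_eq_mul]

theorem integrable_exp_neg_metricSq {A : Matrix (Fin n) (Fin n) ℝ} {c : ℝ} (hc : 0 < c)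
    (hA : ∀ v, c * ‖v‖ ^ 2 ≤ metricSq A v) {b : ℝ} (hb : 0 < b) :
    Integrable fun v => Real.exp (-b * metricSq A v) := by
  refine (integrable_exp_neg_mul_norm_sq (n := n) (mul_pos hb hc)).mono'
    (by have := continuous_metricSq_right A; fun_prop) (Eventually.of_forall fun v => ?_)
  rw [Real.norm_of_nonneg (Real.exp_nonneg _)]
  refine Real.exp_le_exp.2 ?_
  nlinarith [hA v]

theorem integral_exp_neg_metricSq_pos {A : Matrix (Fin n) (Fin n) ℝ} {c : ℝ} (hc : 0 < c)
    (hA : ∀ v, c * ‖v‖ ^ 2 ≤ metricSq A v) {b : ℝ} (hb : 0 < b) :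
    0 < ∫ v, Real.exp (-b * metricSq A v) :=
  integral_exp_pos (integrable_exp_neg_metricSq hc hA hb)

theorem gaussKernel_pos (M : EuclideanSpace ℝ (Fin n) → Matrix (Fin n) (Fin n) ℝ)
    (lam : ℝ) (μ x : EuclideanSpace ℝ (Fin n)) : 0 < gaussKernel M lam μ x :=
  Real.exp_pos _

theorem integrable_gaussKernel {M : EuclideanSpace ℝ (Fin n) → Matrix (Fin n) (Fin n) ℝ}
    {μ : EuclideanSpace ℝ (Fin n)} {c : ℝ} (hc : 0 < c)
    (hμ : ∀ v, c * ‖v‖ ^ 2 ≤ metricSq (M μ) v) {lam : ℝ} (hlam : 0 < lam) :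
    Integrable (gaussKernel M lam μ) :=
  (integrable_exp_neg_metricSq hc hμ (half_pos hlam)).comp_sub_right μ

/-- A thickness bound for the domain bounds the normalizing constant from below. -/
theorem le_gaussZ {X : Set (EuclideanSpace ℝ (Fin n))} (hX : MeasurableSet X)
    {M : EuclideanSpace ℝ (Fin n) → Matrix (Fin n) (Fin n) ℝ}
    {μ : EuclideanSpace ℝ (Fin n)} {c : ℝ} (hc : 0 < c)
    (hμ : ∀ v, c * ‖v‖ ^ 2 ≤ metricSq (M μ) v) {C : ℝ} (hC : 0 ≤ C)
    (hμ_le : ∀ v, metricSq (M μ) v ≤ C * ‖v‖ ^ 2) {lam : ℝ} (hlam : 0 < lam) (r : ℝ) :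
    volume.real (X ∩ Metric.ball μ r) * Real.exp (-(lam / 2) * (C * r ^ 2)) ≤
      gaussZ X M lam μ := by
  have h_int := integrable_gaussKernel hc hμ hlam
  have hms : MeasurableSet (X ∩ Metric.ball μ r) := hX.inter measurableSet_ball
  have hfin : volume (X ∩ Metric.ball μ r) ≠ ⊤ :=
    measure_ne_top_of_subset Set.inter_subset_right measure_ball_lt_top.ne
  calc volume.real (X ∩ Metric.ball μ r) * Real.exp (-(lam / 2) * (C * r ^ 2))
      = ∫ _ in X ∩ Metric.ball μ r, Real.exp (-(lam / 2) * (C * r ^ 2)) := by simp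
    _ ≤ ∫ z in X ∩ Metric.ball μ r, gaussKernel M lam μ z := by
        refine setIntegral_mono_on (integrableOn_const hfin) h_int.integrableOn hms fun z hz => ?_
        refine Real.exp_le_exp.2 (mul_le_mul_of_nonpos_left ((hμ_le _).trans ?_) (by linarith))
        have := mem_ball_iff_norm.1 hz.2
        gcongr
    _ ≤ gaussZ X M lam μ :=
        setIntegral_mono_set h_int.integrableOn
          (Eventually.of_forall fun z => (gaussKernel_pos M lam μ z).le)
          Set.inter_subset_left.eventuallyLE

/-- The normalizing constant at unit scale. -/
theorem sqrt_pow_mul_gaussZ {X : Set (EuclideanSpace ℝ (Fin n))} (hX : MeasurableSet X)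
    (M : EuclideanSpace ℝ (Fin n) → Matrix (Fin n) (Fin n) ℝ)
    (μ : EuclideanSpace ℝ (Fin n)) {lam : ℝ} (hlam : 0 < lam) :
    √lam ^ n * gaussZ X M lam μ = ∫ w, X.indicator (fun _ => (1 : ℝ)) (μ + (√lam)⁻¹ • w) *
      Real.exp (-(1 / 2) * metricSq (M μ) w) := by
  rw [gaussZ, ← integral_indicator hX, ← integral_comp_add_inv_smul _ μ (Real.sqrt_nonneg lam)]
  refine integral_congr_ae (Eventually.of_forall fun w => ?_)
  have hs : ((√lam)⁻¹) ^ 2 * lam = 1 := by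
    rw [inv_pow, Real.sq_sqrt hlam.le, inv_mul_cancel₀ hlam.ne']
  have : gaussKernel M lam μ (μ + (√lam)⁻¹ • w) = Real.exp (-(1 / 2) * metricSq (M μ) w) := by
    rw [gaussKernel, add_sub_cancel_left, metricSq_smul]
    congr 1
    linear_combination (-(1 / 2) * metricSq (M μ) w) * hs
  by_cases h : μ + (√lam)⁻¹ • w ∈ X <;> simp [h, this]

end GaussianIntegral

/-! ### Limits at scale `lam ^ (-1/2)` -/

section ScaleFilter

variable {E : Type*} [NormedAddCommGroup E]

/-- The filter of pairs `(lam, y)` with `lam → ∞` and `‖y - y₀‖ ≤ R / √lam`. -/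
def scaleFilter (y₀ : E) (R : ℝ) : Filter (ℝ × E) :=
  (atTop ×ˢ 𝓝 y₀) ⊓ 𝓟 {z | ‖z.2 - y₀‖ ≤ R / √z.1}

/-- Since `R / √lam → 0`, the constraint alone forces `y` into any given neighbourhood of `y₀`;
limits along the filter are therefore uniform in `y`. -/
theorem eventually_forall_of_scaleFilter {y₀ : E} {R : ℝ} {P : ℝ × E → Prop}
    (h : ∀ᶠ z in scaleFilter y₀ R, P z) :
    ∀ᶠ lam in atTop, ∀ y, ‖y - y₀‖ ≤ R / √lam → P (lam, y) := by
  rw [scaleFilter, eventually_inf_principal, eventually_prod_iff] at h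
  obtain ⟨pa, ha, pb, hb, hab⟩ := h
  obtain ⟨δ, hδ, hball⟩ := Metric.eventually_nhds_iff.1 hb
  have hlim : Tendsto (fun lam : ℝ => R / √lam) atTop (𝓝 0) :=
    tendsto_const_nhds.div_atTop Real.tendsto_sqrt_atTop
  filter_upwards [ha, hlim.eventually_lt_const hδ] with lam hlam hR y hy
  exact hab hlam (hball (by rw [dist_eq_norm]; exact hy.trans_lt hR)) hy

/-- Extracts from a uniform limit the pointwise limits that dominated convergence needs. -/
theorem tendsto_rescale_scaleFilter [NormedSpace ℝ E] (y₀ u : E) :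
    Tendsto (fun lam : ℝ => (lam, y₀ + (√lam)⁻¹ • u)) atTop (scaleFilter y₀ ‖u‖) := by
  refine tendsto_inf.2 ⟨tendsto_id.prodMk ?_, tendsto_principal.2 (Eventually.of_forall ?_)⟩
  · have h : Tendsto (fun lam : ℝ => (√lam)⁻¹ • u) atTop (𝓝 ((0 : ℝ) • u)) :=
      (tendsto_inv_atTop_zero.comp Real.tendsto_sqrt_atTop).smul_const u
    simpa using h.const_add y₀
  · intro lam
    simp [norm_smul, abs_of_nonneg (Real.sqrt_nonneg lam), div_eq_inv_mul]

/-- A quantity of order `o(‖y - y₀‖²)` is negligible against `lam` at scale `lam ^ (-1/2)`. -/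
theorem tendsto_mul_scaleFilter {y₀ : E} (R : ℝ) {h : E → ℝ}
    (hh : h =o[𝓝 y₀] fun y => ‖y - y₀‖ ^ 2) :
    Tendsto (fun z : ℝ × E => z.1 * h z.2) (scaleFilter y₀ R) (𝓝 0) := by
  rw [Metric.tendsto_nhds]
  intro ε hε
  -- The `+ 1` covers `R = 0` and makes the final inequality strict.
  have hb := hh.bound (show 0 < ε / (R ^ 2 + 1) by positivity)
  rw [scaleFilter, eventually_inf_principal]
  filter_upwards [(eventually_gt_atTop (0 : ℝ)).prod_mk hb] with z ⟨hz, hzb⟩ hzR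
  have hs : 0 < √z.1 := Real.sqrt_pos.2 hz
  have h1 : ‖z.2 - y₀‖ * √z.1 ≤ R := (le_div_iff₀ hs).1 hzR
  have h2 : ‖z.2 - y₀‖ ^ 2 * z.1 ≤ R ^ 2 := by
    rw [← Real.sq_sqrt hz.le, ← mul_pow]
    exact pow_le_pow_left₀ (by positivity) h1 2
  rw [norm_pow, norm_norm, Real.norm_eq_abs] at hzb
  rw [dist_zero_right, Real.norm_eq_abs, abs_mul, abs_of_pos hz]
  calc z.1 * |h z.2| ≤ z.1 * (ε / (R ^ 2 + 1) * ‖z.2 - y₀‖ ^ 2) := by gcongr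
    _ = ε / (R ^ 2 + 1) * (‖z.2 - y₀‖ ^ 2 * z.1) := by ring
    _ ≤ ε / (R ^ 2 + 1) * R ^ 2 := by gcongr
    _ < ε := by
      rw [div_mul_eq_mul_div, div_lt_iff₀ (by positivity)]
      nlinarith

end ScaleFilter

/-! ### Concentration in `L¹` at a point -/

section Concentration

variable {n : ℕ}

/-- If the functions `a lam`, viewed at scale `lam ^ (-1/2)` around `y₀`, converge to `β` with a
Gaussian bound near `y₀`, and have negligible mass away from `y₀`, then they are close in `L¹` to
the rescalings of `β`. -/
theorem tendsto_integral_abs_sub_rescaled {Y : Set (EuclideanSpace ℝ (Fin n))} (hY : IsOpen Y)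
    {y₀ : EuclideanSpace ℝ (Fin n)} (hy₀ : y₀ ∈ Y)
    {a : ℝ → EuclideanSpace ℝ (Fin n) → ℝ} {β : EuclideanSpace ℝ (Fin n) → ℝ}
    (ha_int : ∀ᶠ lam in atTop, IntegrableOn (a lam) Y)
    (ha_nonneg : ∀ᶠ lam in atTop, ∀ y ∈ Y, 0 ≤ a lam y)
    (hβ : Integrable β)
    (hlim : ∀ u, Tendsto (fun lam => (√lam ^ n)⁻¹ * a lam (y₀ + (√lam)⁻¹ • u)) atTop (𝓝 (β u)))
    {K κ : ℝ} (hκ : 0 < κ)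
    (hbound : ∀ᶠ z : ℝ × EuclideanSpace ℝ (Fin n) in atTop ×ˢ 𝓝 y₀,
      a z.1 z.2 ≤ √z.1 ^ n * (K * Real.exp (-κ * (z.1 * ‖z.2 - y₀‖ ^ 2))))
    (hfar : ∀ δ > 0, Tendsto (fun lam => ∫ y in Y \ Metric.ball y₀ δ, a lam y) atTop (𝓝 0)) :
    Tendsto (fun lam => ∫ y in Y, |a lam y - √lam ^ n * β (√lam • (y - y₀))|) atTop (𝓝 0) := by
  obtain ⟨pa, hpa, pb, hpb, hab⟩ := eventually_prod_iff.1 hbound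
  obtain ⟨δ, hδ, hball⟩ := Metric.eventually_nhds_iff_ball.1 (hpb.and (hY.mem_nhds hy₀))
  -- A ball inside `Y` on which the Gaussian bound holds; `F` below is the difference at unit scale,
  -- with `a lam` cut off to this ball.
  set B := Metric.ball y₀ δ with hB
  have hBY : B ⊆ Y := fun y hy => (hball y hy).2
  have hBm : MeasurableSet B := measurableSet_ball
  set F : ℝ → EuclideanSpace ℝ (Fin n) → ℝ := fun lam u =>
    |(√lam ^ n)⁻¹ * B.indicator (a lam) (y₀ + (√lam)⁻¹ • u) - β u| with hF
  have hresc (u : EuclideanSpace ℝ (Fin n)) :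
      Tendsto (fun lam : ℝ => y₀ + (√lam)⁻¹ • u) atTop (𝓝 y₀) :=
    (tendsto_snd.comp ((tendsto_rescale_scaleFilter y₀ u).mono_right inf_le_left))
  have hnear : Tendsto (fun lam => ∫ u, F lam u) atTop (𝓝 0) := by
    have h0 : (0 : ℝ) = ∫ _ : EuclideanSpace ℝ (Fin n), (0 : ℝ) := by simp
    rw [h0]
    refine tendsto_integral_filter_of_dominated_convergence
      (fun u => |K| * Real.exp (-κ * ‖u‖ ^ 2) + |β u|) ?_ ?_ ?_ ?_
    · filter_upwards [ha_int, eventually_gt_atTop 0] with lam hl hpos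
      have hs : (√lam)⁻¹ ≠ 0 := (inv_pos.2 (Real.sqrt_pos.2 hpos)).ne'
      have h1 : Integrable (B.indicator (a lam)) := (hl.mono_set hBY).integrable_indicator hBm
      have h2 : Integrable fun u => B.indicator (a lam) (y₀ + (√lam)⁻¹ • u) :=
        (h1.comp_add_left y₀).comp_smul hs
      exact ((h2.const_mul _).sub hβ).abs.aestronglyMeasurable
    · filter_upwards [hpa, ha_nonneg, eventually_gt_atTop 0] with lam hl hnn hpos
      refine Eventually.of_forall fun u => ?_
      have hs : 0 < √lam := Real.sqrt_pos.2 hpos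
      simp only [hF, Real.norm_eq_abs, abs_abs]
      refine (abs_sub _ _).trans (add_le_add_left ?_ _)
      by_cases hu : y₀ + (√lam)⁻¹ • u ∈ B
      · rw [Set.indicator_of_mem hu, abs_of_nonneg (mul_nonneg (by positivity) (hnn _ (hBY hu)))]
        have h := hab hl (hball _ hu).1
        rw [inv_mul_le_iff₀ (by positivity)]
        refine h.trans ?_
        have hnorm : lam * ‖y₀ + (√lam)⁻¹ • u - y₀‖ ^ 2 = ‖u‖ ^ 2 := by
          rw [add_sub_cancel_left, norm_smul, mul_pow, Real.norm_of_nonneg (by positivity), inv_pow,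
            Real.sq_sqrt hpos.le, mul_inv_cancel_left₀ hpos.ne']
        simp only [hnorm]
        gcongr
        exact le_abs_self K
      · rw [Set.indicator_of_notMem hu, mul_zero, abs_zero]
        positivity
    · exact ((integrable_exp_neg_mul_norm_sq hκ).const_mul _).add hβ.abs
    · refine Eventually.of_forall fun u => ?_
      have h1 : Tendsto (fun lam => (√lam ^ n)⁻¹ * B.indicator (a lam) (y₀ + (√lam)⁻¹ • u)) atTop
          (𝓝 (β u)) := by
        refine (hlim u).congr' ?_
        filter_upwards [(hresc u).eventually (Metric.ball_mem_nhds y₀ hδ)] with lam hl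
        rw [Set.indicator_of_mem (show _ ∈ B from hl)]
      simpa using (h1.sub_const (β u)).abs
  -- On `Y` the difference is at most the cut-off difference plus `a lam` off the ball: there the
  -- cut-off difference is the rescaled `β` alone.
  refine squeeze_zero' (Eventually.of_forall fun lam => by positivity) ?_
    (by simpa using hnear.add (hfar δ hδ))
  filter_upwards [ha_int, ha_nonneg, eventually_gt_atTop 0] with lam hl hnn hpos
  have hs : 0 < √lam := Real.sqrt_pos.2 hpos
  have hb_int : Integrable fun y => √lam ^ n * β (√lam • (y - y₀)) :=
    (((hβ.comp_smul hs.ne').comp_sub_right y₀)).const_mul _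
  have h1 : Integrable (B.indicator (a lam)) := (hl.mono_set hBY).integrable_indicator hBm
  have hFint : ∫ u, F lam u = ∫ y, |B.indicator (a lam) y - √lam ^ n * β (√lam • (y - y₀))| := by
    have := integral_comp_add_inv_smul
      (fun y => |B.indicator (a lam) y - √lam ^ n * β (√lam • (y - y₀))|) y₀ hs.le
    rw [← inv_mul_eq_iff_eq_mul₀ (by positivity), ← integral_const_mul] at this
    rw [← this]
    refine integral_congr_ae (Eventually.of_forall fun u => ?_)
    simp only [hF, add_sub_cancel_left, smul_inv_smul₀ hs.ne']
    rw [← abs_of_pos (inv_pos.2 (pow_pos hs n)), ← abs_mul, mul_sub,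
      inv_mul_cancel_left₀ (by positivity), abs_of_pos (inv_pos.2 (pow_pos hs n))]
  have hYd : MeasurableSet (Y \ B) := hY.measurableSet.diff hBm
  have hfar_int : Integrable ((Y \ B).indicator (a lam)) :=
    (hl.mono_set Set.sdiff_subset).integrable_indicator hYd
  have hsub_int : Integrable fun y =>
      |B.indicator (a lam) y - √lam ^ n * β (√lam • (y - y₀))| := (h1.sub hb_int).abs
  rw [hFint, ← integral_indicator hYd, ← integral_add hsub_int hfar_int,
    ← integral_indicator hY.measurableSet]
  have habs_int : IntegrableOn (fun y => |a lam y - √lam ^ n * β (√lam • (y - y₀))|) Y :=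
    (hl.sub hb_int.integrableOn).abs
  refine integral_mono (habs_int.integrable_indicator hY.measurableSet)
    (hsub_int.add hfar_int) fun y => ?_
  by_cases hyB : y ∈ B
  · simp [hyB, hBY hyB]
  · by_cases hyY : y ∈ Y
    · simp only [Set.indicator_of_mem hyY, Set.indicator_of_notMem hyB,
        Set.indicator_of_mem (show y ∈ Y \ B from ⟨hyY, hyB⟩)]
      have := abs_sub (a lam y) (√lam ^ n * β (√lam • (y - y₀)))
      rw [abs_of_nonneg (hnn y hyY)] at this
      rw [zero_sub, abs_neg]
      linarith
    · simp only [Set.indicator_of_notMem hyY, Set.indicator_of_notMem hyB,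
        Set.indicator_of_notMem (show y ∉ Y \ B from fun hy => hyY hy.1)]
      positivity

/-- The mass of the rescalings of an integrable function on a neighbourhood of the centre. -/
theorem tendsto_integral_rescaled {Y : Set (EuclideanSpace ℝ (Fin n))} (hY : IsOpen Y)
    {y₀ : EuclideanSpace ℝ (Fin n)} (hy₀ : y₀ ∈ Y) {β : EuclideanSpace ℝ (Fin n) → ℝ}
    (hβ : Integrable β) :
    Tendsto (fun lam => ∫ y in Y, √lam ^ n * β (√lam • (y - y₀))) atTop (𝓝 (∫ u, β u)) := by
  have hmeas : MeasurableSet Y := hY.measurableSet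
  -- At unit scale the domain becomes a preimage of `Y` that eventually contains each fixed `u`.
  have h : Tendsto (fun lam : ℝ => ∫ u, ((fun u => y₀ + (√lam)⁻¹ • u) ⁻¹' Y).indicator β u) atTop
      (𝓝 (∫ u, β u)) := by
    refine tendsto_integral_filter_of_dominated_convergence (fun u => ‖β u‖) ?_ ?_ hβ.norm ?_
    · refine Eventually.of_forall fun lam => hβ.aestronglyMeasurable.indicator ?_
      exact (show Continuous fun u : EuclideanSpace ℝ (Fin n) => y₀ + (√lam)⁻¹ • u by
        fun_prop).measurable hmeas
    · exact Eventually.of_forall fun lam => Eventually.of_forall fun u =>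
        norm_indicator_le_norm_self _ _
    · refine Eventually.of_forall fun u => tendsto_const_nhds.congr' ?_
      have hresc : Tendsto (fun lam : ℝ => y₀ + (√lam)⁻¹ • u) atTop (𝓝 y₀) :=
        tendsto_snd.comp ((tendsto_rescale_scaleFilter y₀ u).mono_right inf_le_left)
      filter_upwards [hresc.eventually (hY.mem_nhds hy₀)] with lam hl
      rw [Set.indicator_of_mem (by exact hl)]
  refine h.congr' ?_
  filter_upwards [eventually_gt_atTop 0] with lam hpos
  have hs : 0 < √lam := Real.sqrt_pos.2 hpos
  rw [integral_const_mul, ← integral_indicator hmeas, ← integral_comp_add_inv_smul _ y₀ hs.le]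
  refine integral_congr_ae (Eventually.of_forall fun u => ?_)
  by_cases hu : y₀ + (√lam)⁻¹ • u ∈ Y <;> simp [Set.indicator, hu, smul_inv_smul₀ hs.ne']

end Concentration

/-! ### Stability of normalization in `L¹` -/

section Normalization

variable {α : Type*} [MeasurableSpace α] {μ : Measure α}

/-- Write `a/A - b/B = (a - b)/A + b (B - A)/(A B)`. Each term contributes at most `∫ |a - b| / A`,
whence the factor 2. -/
theorem lintegral_abs_div_integral_sub_le {a b : α → ℝ} (ha : Integrable a μ) (hb : Integrable b μ)
    (hb0 : 0 ≤ᵐ[μ] b) (hA : 0 < ∫ y, a y ∂μ) (hB : 0 < ∫ y, b y ∂μ) :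
    ∫⁻ y, ENNReal.ofReal |a y / (∫ y, a y ∂μ) - b y / (∫ y, b y ∂μ)| ∂μ ≤
      ENNReal.ofReal (2 * (∫ y, |a y - b y| ∂μ) / ∫ y, a y ∂μ) := by
  set A := ∫ y, a y ∂μ with hAd
  set B := ∫ y, b y ∂μ with hBd
  have h_int : Integrable (fun y => a y / A - b y / B) μ := (ha.div_const A).sub (hb.div_const B)
  rw [← ofReal_integral_eq_lintegral_ofReal h_int.abs (Eventually.of_forall fun y => abs_nonneg _)]
  refine ENNReal.ofReal_le_ofReal ?_
  have hAB : |A - B| ≤ ∫ y, |a y - b y| ∂μ := by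
    rw [hAd, hBd, ← integral_sub ha hb]
    exact abs_integral_le_integral_abs
  have hsub : Integrable (fun y => |a y - b y|) μ := (ha.sub hb).abs
  calc ∫ y, |a y / A - b y / B| ∂μ
      ≤ ∫ y, (|a y - b y| * A⁻¹ + b y * (|A - B| / (A * B))) ∂μ := by
        refine integral_mono_ae h_int.abs ((hsub.mul_const _).add (hb.mul_const _)) ?_
        filter_upwards [hb0] with y hy
        have h : a y / A - b y / B = (a y - b y) * A⁻¹ + b y * ((B - A) / (A * B)) := by
          field_simp
          ring
        rw [h]
        refine (abs_add_le _ _).trans (le_of_eq ?_)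
        rw [abs_mul, abs_mul, abs_of_pos (inv_pos.2 hA), abs_of_nonneg hy, abs_div,
          abs_of_pos (mul_pos hA hB), abs_sub_comm B A]
    _ = (∫ y, |a y - b y| ∂μ) * A⁻¹ + B * (|A - B| / (A * B)) := by
        rw [integral_add (hsub.mul_const _) (hb.mul_const _), integral_mul_const,
          integral_mul_const]
    _ = ((∫ y, |a y - b y| ∂μ) + |A - B|) / A := by field_simp
    _ ≤ 2 * (∫ y, |a y - b y| ∂μ) / A := by
        gcongr
        linarith

end Normalization

/-! ### Local and global estimates of the likelihood -/

section Likelihood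

variable {d D : ℕ} {X : Set (EuclideanSpace ℝ (Fin D))}
  {M : EuclideanSpace ℝ (Fin D) → Matrix (Fin D) (Fin D) ℝ}
  {Y : Set (EuclideanSpace ℝ (Fin d))}
  {f : EuclideanSpace ℝ (Fin d) → EuclideanSpace ℝ (Fin D)}
  {p : EuclideanSpace ℝ (Fin d) → ℝ} {y₀ : EuclideanSpace ℝ (Fin d)}

theorem continuousOn_metric_comp (hM : IsMetricOn M X) (hf : IsSmoothEmbeddingOn f Y X) :
    ContinuousOn (fun y => M (f y)) Y :=
  hM.continuousOn.comp hf.smooth.continuousOn hf.mapsTo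

theorem IsSmoothEmbeddingOn.hasFDerivAt (hf : IsSmoothEmbeddingOn f Y X) (hY : IsOpen Y)
    (hy₀ : y₀ ∈ Y) : HasFDerivAt f (fderiv ℝ f y₀) y₀ :=
  ((hf.smooth.contDiffAt (hY.mem_nhds hy₀)).differentiableAt (by simp)).hasFDerivAt

/-- Dominated convergence at unit scale: `X` is open, so its indicator tends to 1 pointwise, and
`hlow` gives a dominating Gaussian independent of `y`. The limit is joint because the centre `f y`
moves. -/
theorem tendsto_sqrt_pow_mul_gaussZ (hX : IsOpen X) (hM : IsMetricOn M X) (hY : IsOpen Y)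
    (hf : IsSmoothEmbeddingOn f Y X) {c : ℝ} (hc : 0 < c)
    (hlow : ∀ y ∈ Y, ∀ v, c * ‖v‖ ^ 2 ≤ metricSq (M (f y)) v) (hy₀ : y₀ ∈ Y) :
    Tendsto (fun z : ℝ × EuclideanSpace ℝ (Fin d) => √z.1 ^ D * gaussZ X M z.1 (f z.2))
      (atTop ×ˢ 𝓝 y₀) (𝓝 (∫ w, Real.exp (-(1 / 2) * metricSq (M (f y₀)) w))) := by
  have hYn : ∀ᶠ z : ℝ × EuclideanSpace ℝ (Fin d) in atTop ×ˢ 𝓝 y₀, z.2 ∈ Y :=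
    tendsto_snd.eventually (hY.mem_nhds hy₀)
  have hpos : ∀ᶠ z : ℝ × EuclideanSpace ℝ (Fin d) in atTop ×ˢ 𝓝 y₀, 0 < z.1 :=
    tendsto_fst.eventually (eventually_gt_atTop 0)
  have hft : Tendsto (fun z : ℝ × EuclideanSpace ℝ (Fin d) => f z.2) (atTop ×ˢ 𝓝 y₀)
      (𝓝 (f y₀)) := (hf.hasFDerivAt hY hy₀).continuousAt.tendsto.comp tendsto_snd
  have hMt : Tendsto (fun z : ℝ × EuclideanSpace ℝ (Fin d) => M (f z.2)) (atTop ×ˢ 𝓝 y₀)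
      (𝓝 (M (f y₀))) :=
    ((continuousOn_metric_comp hM hf).continuousAt (hY.mem_nhds hy₀)).tendsto.comp tendsto_snd
  have h : Tendsto (fun z : ℝ × EuclideanSpace ℝ (Fin d) =>
      ∫ w, X.indicator (fun _ => (1 : ℝ)) (f z.2 + (√z.1)⁻¹ • w) *
        Real.exp (-(1 / 2) * metricSq (M (f z.2)) w)) (atTop ×ˢ 𝓝 y₀)
      (𝓝 (∫ w, Real.exp (-(1 / 2) * metricSq (M (f y₀)) w))) := by
    refine tendsto_integral_filter_of_dominated_convergence
      (fun w => Real.exp (-(1 / 2 * c) * ‖w‖ ^ 2)) ?_ ?_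
      (integrable_exp_neg_mul_norm_sq (by positivity)) ?_
    · refine Eventually.of_forall fun z => AEStronglyMeasurable.mul ?_ ?_
      · have : Measurable fun w : EuclideanSpace ℝ (Fin D) => f z.2 + (√z.1)⁻¹ • w := by fun_prop
        exact ((measurable_const.indicator hX.measurableSet).comp this).aestronglyMeasurable
      · have := continuous_metricSq_right (M (f z.2))
        exact (by fun_prop : Continuous fun w => Real.exp (-(1 / 2) * metricSq (M (f z.2)) w))
          |>.aestronglyMeasurable
    · filter_upwards [hYn] with z hz
      refine Eventually.of_forall fun w => ?_
      rw [norm_mul, Real.norm_of_nonneg (Real.exp_nonneg _)]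
      refine (mul_le_of_le_one_left (Real.exp_nonneg _) ?_).trans (Real.exp_le_exp.2 ?_)
      · exact (norm_indicator_le_norm_self _ _).trans (by simp)
      · linarith [hlow _ hz w]
    · refine Eventually.of_forall fun w => ?_
      have hinv : Tendsto (fun z : ℝ × EuclideanSpace ℝ (Fin d) => f z.2 + (√z.1)⁻¹ • w)
          (atTop ×ˢ 𝓝 y₀) (𝓝 (f y₀)) := by
        have h0 : Tendsto (fun z : ℝ × EuclideanSpace ℝ (Fin d) => (√z.1)⁻¹ • w)
            (atTop ×ˢ 𝓝 y₀) (𝓝 ((0 : ℝ) • w)) :=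
          ((tendsto_inv_atTop_zero.comp Real.tendsto_sqrt_atTop).comp tendsto_fst).smul_const w
        simpa using hft.add h0
      have hexp : Tendsto (fun z : ℝ × EuclideanSpace ℝ (Fin d) =>
          Real.exp (-(1 / 2) * metricSq (M (f z.2)) w)) (atTop ×ˢ 𝓝 y₀)
          (𝓝 (Real.exp (-(1 / 2) * metricSq (M (f y₀)) w))) := by
        have h1 := (continuous_metricSq.tendsto (M (f y₀), w)).comp
          (hMt.prodMk_nhds (tendsto_const_nhds (x := w)))
        exact (Real.continuous_exp.tendsto _).comp (h1.const_mul _)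
      refine hexp.congr' ?_
      filter_upwards [hinv.eventually (hX.mem_nhds (hf.mapsTo hy₀))] with z hz
      rw [Set.indicator_of_mem hz, one_mul]
  refine h.congr' ?_
  filter_upwards [hpos] with z hz
  rw [sqrt_pow_mul_gaussZ hX.measurableSet M _ hz]

/-- The squared distance from `f y` to `f y₀` is, to second order, the pull-back metric. -/
theorem metricSq_sub_pullbackMetric_isLittleO (hM : IsMetricOn M X) (hY : IsOpen Y)
    (hf : IsSmoothEmbeddingOn f Y X) (hy₀ : y₀ ∈ Y) :
    (fun y => metricSq (M (f y)) (f y₀ - f y) - metricSq (pullbackMetric f M y₀) (y - y₀))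
      =o[𝓝 y₀] fun y => ‖y - y₀‖ ^ 2 := by
  have hd := hf.hasFDerivAt hY hy₀
  have hMc : ContinuousAt (fun y => M (f y)) y₀ :=
    (continuousOn_metric_comp hM hf).continuousAt (hY.mem_nhds hy₀)
  have hK : (fun y => ∑ i, ∑ j, |(M (f y) - M (f y₀)) i j|) =o[𝓝 y₀] fun _ => (1 : ℝ) := by
    rw [Asymptotics.isLittleO_one_iff]
    have hcont : Continuous fun A : Matrix (Fin D) (Fin D) ℝ =>
        ∑ i, ∑ j, |(A - M (f y₀)) i j| := by
      simp only [Matrix.sub_apply]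
      fun_prop
    have := (hcont.tendsto (M (f y₀))).comp hMc.tendsto
    simpa [Function.comp_def] using this
  have hv : (fun y => f y - f y₀) =O[𝓝 y₀] fun y => y - y₀ := hd.isBigO_sub
  have hw : (fun y => fderiv ℝ f y₀ (y - y₀)) =O[𝓝 y₀] fun y => y - y₀ :=
    ContinuousLinearMap.isBigO_comp _ _ _
  have hvw : (fun y => f y - f y₀ - fderiv ℝ f y₀ (y - y₀)) =o[𝓝 y₀] fun y => y - y₀ :=
    hd.isLittleO
  -- Variation of the metric: `o(1)` times `O(‖y - y₀‖²)`. Next, the linearization error: `o(‖y -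
  -- y₀‖)` times `O(‖y - y₀‖)`.
  have h1 := hK.mul_isBigO (hv.norm_norm.pow 2)
  have h2 := ((hvw.norm_norm).mul_isBigO (hv.norm_norm.add hw.norm_norm)).const_mul_left
    (∑ i, ∑ j, |M (f y₀) i j|)
  have h12 := (h1.congr_right (g₂ := fun y => ‖y - y₀‖ ^ 2) fun y => one_mul _).add
    (h2.congr_right (g₂ := fun y => ‖y - y₀‖ ^ 2) fun y => (sq _).symm)
  refine Asymptotics.IsBigO.trans_isLittleO
    (Asymptotics.IsBigO.of_norm_le fun y => ?_) h12
  rw [metricSq_sub_comm, metricSq_pullbackMetric, Real.norm_eq_abs]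
  exact abs_metricSq_sub_metricSq_le _ _ _ _

/-- The derivative expands by at least `k` and near `y₀` the remainder costs at most `k / 2`. -/
theorem eventually_mul_norm_sq_le_metricSq (hY : IsOpen Y) (hf : IsSmoothEmbeddingOn f Y X)
    {c : ℝ} (hc : 0 < c) (hlow : ∀ y ∈ Y, ∀ v, c * ‖v‖ ^ 2 ≤ metricSq (M (f y)) v)
    (hy₀ : y₀ ∈ Y) :
    ∃ κ : ℝ, 0 < κ ∧ ∀ᶠ y in 𝓝 y₀, κ * ‖y - y₀‖ ^ 2 ≤ metricSq (M (f y)) (f y₀ - f y) := by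
  obtain ⟨k, hk, hkv⟩ := exists_mul_norm_le_fderiv (hf.fullRank y₀ hy₀)
  refine ⟨c * (k / 2) ^ 2, by positivity, ?_⟩
  filter_upwards [(hf.hasFDerivAt hY hy₀).isLittleO.bound (half_pos hk), hY.mem_nhds hy₀]
    with y hy hyY
  have h1 := hkv (y - y₀)
  have h2 : ‖fderiv ℝ f y₀ (y - y₀)‖ ≤ ‖f y - f y₀‖ + ‖f y - f y₀ - fderiv ℝ f y₀ (y - y₀)‖ := by
    have := norm_sub_le (f y - f y₀) (f y - f y₀ - fderiv ℝ f y₀ (y - y₀))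
    simpa using this
  have h3 : k / 2 * ‖y - y₀‖ ≤ ‖f y₀ - f y‖ := by
    rw [norm_sub_rev (f y₀)]
    linarith
  calc c * (k / 2) ^ 2 * ‖y - y₀‖ ^ 2 = c * (k / 2 * ‖y - y₀‖) ^ 2 := by ring
    _ ≤ c * ‖f y₀ - f y‖ ^ 2 := by gcongr
    _ ≤ _ := hlow y hyY _

theorem exists_mul_norm_sq_le_pullbackMetric (hf : IsSmoothEmbeddingOn f Y X)
    {c : ℝ} (hc : 0 < c) (hlow : ∀ y ∈ Y, ∀ v, c * ‖v‖ ^ 2 ≤ metricSq (M (f y)) v)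
    (hy₀ : y₀ ∈ Y) :
    ∃ κ : ℝ, 0 < κ ∧ ∀ v, κ * ‖v‖ ^ 2 ≤ metricSq (pullbackMetric f M y₀) v := by
  obtain ⟨k, hk, hkv⟩ := exists_mul_norm_le_fderiv (hf.fullRank y₀ hy₀)
  refine ⟨c * k ^ 2, by positivity, fun v => ?_⟩
  rw [metricSq_pullbackMetric]
  calc c * k ^ 2 * ‖v‖ ^ 2 = c * (k * ‖v‖) ^ 2 := by ring
    _ ≤ c * ‖fderiv ℝ f y₀ v‖ ^ 2 := by gcongr; exact hkv v
    _ ≤ _ := hlow y₀ hy₀ _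

/-- The topology of `Y` is induced by `f`. An injective immersion would not do: its image may return
arbitrarily close to `f y₀`. -/
theorem IsSmoothEmbeddingOn.exists_le_norm_sub (hf : IsSmoothEmbeddingOn f Y X) (hy₀ : y₀ ∈ Y)
    {δ : ℝ} (hδ : 0 < δ) :
    ∃ η : ℝ, 0 < η ∧ ∀ y ∈ Y, δ ≤ ‖y - y₀‖ → η ≤ ‖f y₀ - f y‖ := by
  have h : {y : Y | ‖(y : EuclideanSpace ℝ (Fin d)) - y₀‖ < δ} ∈ 𝓝 (⟨y₀, hy₀⟩ : Y) := by
    refine IsOpen.mem_nhds (isOpen_lt (by fun_prop) continuous_const) ?_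
    simpa using hδ
  rw [hf.isEmbedding.nhds_eq_comap, (Metric.nhds_basis_ball.comap _).mem_iff] at h
  obtain ⟨η, hη, hsub⟩ := h
  refine ⟨η, hη, fun y hy hyδ => ?_⟩
  by_contra! hlt
  have : (⟨y, hy⟩ : Y) ∈ Y.domRestrict f ⁻¹' Metric.ball (Y.domRestrict f ⟨y₀, hy₀⟩) η := by
    rw [Set.mem_preimage, mem_ball_iff_norm, norm_sub_rev]
    exact hlt
  exact absurd (hsub this) (not_lt.2 hyδ)

/-- Along `f(Y)` the normalizing constants decay at most at an arbitrarily small exponential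
rate. -/
theorem UniformAlong.exists_le_gaussZ (h : UniformAlong X M Y f) (hX : IsOpen X) (hy₀ : y₀ ∈ Y)
    {τ : ℝ} (hτ : 0 < τ) :
    ∃ m : ℝ, 0 < m ∧ ∀ lam > 0, ∀ y ∈ Y, m * Real.exp (-(lam * τ)) ≤ gaussZ X M lam (f y) := by
  obtain ⟨c, hc, hlow⟩ := h.lower
  obtain ⟨C, hup⟩ := h.upper
  -- `C` need not be positive. The radius below solves `C₁ * r ^ 2 / 2 = τ`.
  set C₁ := max C 1
  have hC₁ : 1 ≤ C₁ := le_max_right _ _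
  have hr : 0 < √(2 * τ / C₁) := by positivity
  obtain ⟨m, hm, hvol⟩ := h.thick _ hr
  have hfin : ∀ y, volume (X ∩ Metric.ball (f y) √(2 * τ / C₁)) ≠ ⊤ := fun y =>
    measure_ne_top_of_subset Set.inter_subset_right measure_ball_lt_top.ne
  have hmtop : m ≠ ⊤ := ne_top_of_le_ne_top (hfin y₀) (hvol y₀ hy₀)
  refine ⟨m.toReal, ENNReal.toReal_pos hm.ne' hmtop, fun lam hlam y hy => ?_⟩
  have hZ := le_gaussZ hX.measurableSet hc (hlow y hy) (zero_le_one.trans hC₁)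
    (fun v => (hup y hy v).trans (by gcongr; exact le_max_left _ _)) hlam √(2 * τ / C₁)
  have hexp : -(lam / 2) * (C₁ * √(2 * τ / C₁) ^ 2) = -(lam * τ) := by
    rw [Real.sq_sqrt (by positivity)]
    field_simp
  rw [hexp] at hZ
  refine le_trans ?_ hZ
  gcongr
  exact ENNReal.toReal_mono (hfin y) (hvol y hy)

theorem gaussZ_pos_of_uniformAlong (h : UniformAlong X M Y f) (hX : IsOpen X) {lam : ℝ}
    (hlam : 0 < lam) {y : EuclideanSpace ℝ (Fin d)} (hy : y ∈ Y) : 0 < gaussZ X M lam (f y) := by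
  obtain ⟨m, hm, hZ⟩ := h.exists_le_gaussZ hX hy one_pos
  exact lt_of_lt_of_le (by positivity) (hZ lam hlam y hy)

theorem jointDensity_nonneg (h : UniformAlong X M Y f) (hX : IsOpen X)
    (hp : ∀ y ∈ Y, 0 ≤ p y) {lam : ℝ} (hlam : 0 < lam) (x : EuclideanSpace ℝ (Fin D))
    {y : EuclideanSpace ℝ (Fin d)} (hy : y ∈ Y) : 0 ≤ jointDensity X M f p lam x y :=
  mul_nonneg (hp y hy) (div_nonneg (gaussKernel_pos _ _ _ _).le
    (gaussZ_pos_of_uniformAlong h hX hlam hy).le)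

/-- Regularity is known only on `Y`, so the argument runs on the subtype. For `gaussZ`,
measurability of a parametric integral suffices. -/
theorem aestronglyMeasurable_jointDensity (hM : IsMetricOn M X) (hY : IsOpen Y)
    (hf : IsSmoothEmbeddingOn f Y X) (hp : ContinuousOn p Y) (lam : ℝ)
    (x : EuclideanSpace ℝ (Fin D)) :
    AEStronglyMeasurable (jointDensity X M f p lam x) (volume.restrict Y) := by
  have hker : Continuous fun q : Y × EuclideanSpace ℝ (Fin D) =>
      gaussKernel M lam (f q.1) q.2 := by
    have hMc : Continuous fun y : Y => M (f y) :=
      continuousOn_iff_continuous_domRestrict.1 (continuousOn_metric_comp hM hf)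
    have hfc : Continuous fun y : Y => f y :=
      continuousOn_iff_continuous_domRestrict.1 hf.smooth.continuousOn
    have : Continuous fun q : Y × EuclideanSpace ℝ (Fin D) => metricSq (M (f q.1)) (q.2 - f q.1) :=
      continuous_metricSq.comp ((hMc.comp continuous_fst).prodMk
        (continuous_snd.sub (hfc.comp continuous_fst)))
    unfold gaussKernel
    fun_prop
  have hZ : StronglyMeasurable fun y : Y => gaussZ X M lam (f y) :=
    hker.stronglyMeasurable.integral_prod_right (ν := volume.restrict X)
  have hpm : StronglyMeasurable fun y : Y => p y :=
    (continuousOn_iff_continuous_domRestrict.1 hp).stronglyMeasurable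
  have hkx : StronglyMeasurable fun y : Y => gaussKernel M lam (f y) x :=
    (hker.comp (Continuous.prodMk_left x)).stronglyMeasurable
  have hj : StronglyMeasurable fun y : Y => jointDensity X M f p lam x y :=
    hpm.mul (hkx.div hZ)
  rw [← map_comap_subtype_coe hY.measurableSet,
    (MeasurableEmbedding.subtype_coe hY.measurableSet).aestronglyMeasurable_map_iff]
  exact hj.aestronglyMeasurable

/-- The joint density is exponentially small, relative to the prior, where `f y` stays away from
the observation. -/
theorem exists_jointDensity_le (h : UniformAlong X M Y f) (hX : IsOpen X)
    (hp : ∀ y ∈ Y, 0 ≤ p y) {c : ℝ}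
    (hlow : ∀ y ∈ Y, ∀ v, c * ‖v‖ ^ 2 ≤ metricSq (M (f y)) v) (hy₀ : y₀ ∈ Y) {σ : ℝ}
    (hσ : 0 < σ) :
    ∃ K : ℝ, 0 < K ∧ ∀ lam > 0, ∀ x, ∀ y ∈ Y, ∀ t, t ≤ c / 2 * ‖x - f y‖ ^ 2 →
      jointDensity X M f p lam x y ≤ p y * (K * Real.exp (-(lam * (t - σ)))) := by
  obtain ⟨m, hm, hZ⟩ := h.exists_le_gaussZ hX hy₀ hσ
  refine ⟨m⁻¹, by positivity, fun lam hlam x y hy t ht => ?_⟩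
  refine mul_le_mul_of_nonneg_left ?_ (hp y hy)
  rw [gaussDensity, div_le_iff₀ (gaussZ_pos_of_uniformAlong h hX hlam hy)]
  have h1 : gaussKernel M lam (f y) x ≤ Real.exp (-(lam * t)) := by
    refine Real.exp_le_exp.2 ?_
    have := hlow y hy (x - f y)
    nlinarith
  refine h1.trans ?_
  calc Real.exp (-(lam * t))
      = m⁻¹ * Real.exp (-(lam * (t - σ))) * (m * Real.exp (-(lam * σ))) := by
        rw [mul_mul_mul_comm, inv_mul_cancel₀ hm.ne', one_mul, ← Real.exp_add]
        congr 1
        ring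
    _ ≤ _ := by gcongr; exact hZ lam hlam y hy

theorem integrableOn_jointDensity (h : UniformAlong X M Y f) (hX : IsOpen X)
    (hM : IsMetricOn M X) (hY : IsOpen Y) (hf : IsSmoothEmbeddingOn f Y X)
    (hp_cont : ContinuousOn p Y) (hp : ∀ y ∈ Y, 0 ≤ p y) (hp_int : IntegrableOn p Y)
    (hy₀ : y₀ ∈ Y) {lam : ℝ} (hlam : 0 < lam) (x : EuclideanSpace ℝ (Fin D)) :
    IntegrableOn (jointDensity X M f p lam x) Y := by
  obtain ⟨c, hc, hlow⟩ := h.lower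
  obtain ⟨K, hK, hle⟩ := exists_jointDensity_le h hX hp hlow hy₀ one_pos
  refine (hp_int.mul_const (K * Real.exp (-(lam * (0 - 1))))).mono'
    (aestronglyMeasurable_jointDensity hM hY hf hp_cont lam x) ?_
  refine (ae_restrict_iff' hY.measurableSet).2 (Eventually.of_forall fun y hy => ?_)
  rw [Real.norm_of_nonneg (jointDensity_nonneg h hX hp hlam x hy)]
  -- At fixed `lam` no decay is needed: `t = 0` already bounds the joint density by a multiple of
  -- the prior.
  exact hle lam hlam x y hy 0 (by positivity)

theorem evidence_pos (h : UniformAlong X M Y f) (hX : IsOpen X)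
    (hM : IsMetricOn M X) (hY : IsOpen Y) (hf : IsSmoothEmbeddingOn f Y X)
    (hp_cont : ContinuousOn p Y) (hp : ∀ y ∈ Y, 0 ≤ p y) (hp_int : IntegrableOn p Y)
    (hy₀ : y₀ ∈ Y) (hp_pos : 0 < p y₀) {lam : ℝ} (hlam : 0 < lam)
    (x : EuclideanSpace ℝ (Fin D)) : 0 < evidence X M Y f p lam x := by
  rw [evidence, setIntegral_pos_iff_support_of_nonneg_ae
    ((ae_restrict_iff' hY.measurableSet).2
      (Eventually.of_forall fun y hy => jointDensity_nonneg h hX hp hlam x hy))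
    (integrableOn_jointDensity h hX hM hY hf hp_cont hp hp_int hy₀ hlam x)]
  refine Measure.measure_pos_of_mem_nhds volume (x := y₀) ?_
  filter_upwards [hY.mem_nhds hy₀,
    (hp_cont.continuousAt (hY.mem_nhds hy₀)).eventually (lt_mem_nhds hp_pos)] with y hy hpy
  exact ⟨(mul_pos hpy (div_pos (gaussKernel_pos _ _ _ _)
    (gaussZ_pos_of_uniformAlong h hX hlam hy))).ne', hy⟩

/-- The mass of the joint density away from the preimage of the observation is negligible. -/
theorem tendsto_setIntegral_jointDensity_diff_ball (h : UniformAlong X M Y f) (hX : IsOpen X)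
    (hM : IsMetricOn M X) (hY : IsOpen Y) (hf : IsSmoothEmbeddingOn f Y X)
    (hp_cont : ContinuousOn p Y) (hp : ∀ y ∈ Y, 0 ≤ p y) (hp_int : IntegrableOn p Y)
    (hy₀ : y₀ ∈ Y) {δ : ℝ} (hδ : 0 < δ) :
    Tendsto (fun lam => ∫ y in Y \ Metric.ball y₀ δ,
      √lam ^ d / √lam ^ D * jointDensity X M f p lam (f y₀) y) atTop (𝓝 0) := by
  obtain ⟨c, hc, hlow⟩ := h.lower
  obtain ⟨η, hη, hsep⟩ := hf.exists_le_norm_sub hy₀ hδ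
  -- Half the decay rate `c * η ^ 2 / 2` of the kernel. The normalizing constant costs the rate `σ`,
  -- and the remaining `exp (-(σ * lam))` beats the polynomial factor.
  set σ := c * η ^ 2 / 4 with hσ_def
  have hσ : 0 < σ := by positivity
  obtain ⟨K, hK, hle⟩ := exists_jointDensity_le h hX hp hlow hy₀ hσ
  have hms : MeasurableSet (Y \ Metric.ball y₀ δ) := hY.measurableSet.diff measurableSet_ball
  set I := ∫ y in Y \ Metric.ball y₀ δ, p y with hI
  have hlim : Tendsto (fun lam : ℝ => I * K * (σ ^ d)⁻¹ * ((σ * lam) ^ d * Real.exp (-(σ * lam))))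
      atTop (𝓝 0) := by
    have := ((Real.tendsto_pow_mul_exp_neg_atTop_nhds_zero d).comp
      (tendsto_id.const_mul_atTop hσ)).const_mul (I * K * (σ ^ d)⁻¹)
    simpa [Function.comp_def] using this
  refine squeeze_zero' ?_ ?_ hlim
  · filter_upwards [eventually_gt_atTop 0] with lam hlam
    exact setIntegral_nonneg hms fun y hy =>
      mul_nonneg (by positivity) (jointDensity_nonneg h hX hp hlam _ hy.1)
  · filter_upwards [eventually_ge_atTop 1] with lam hlam1
    have hlam : 0 < lam := by linarith
    have h_int := integrableOn_jointDensity h hX hM hY hf hp_cont hp hp_int hy₀ hlam (f y₀)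
    have hs1 : 1 ≤ √lam := Real.one_le_sqrt.2 hlam1
    have hfac : √lam ^ d / √lam ^ D ≤ lam ^ d := by
      refine (div_le_self (by positivity) (one_le_pow₀ hs1)).trans ?_
      gcongr
      exact (Real.sqrt_le_left hlam.le).2 (by nlinarith)
    have hj : ∫ y in Y \ Metric.ball y₀ δ, jointDensity X M f p lam (f y₀) y ≤
        I * (K * Real.exp (-(σ * lam))) := by
      rw [hI, ← integral_mul_const]
      refine setIntegral_mono_on (h_int.mono_set Set.sdiff_subset)
        ((hp_int.mono_set Set.sdiff_subset).mul_const _) hms fun y hy => ?_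
      have hyδ : δ ≤ ‖y - y₀‖ := not_lt.1 fun hlt => hy.2 (mem_ball_iff_norm.2 hlt)
      have := hle lam hlam (f y₀) y hy.1 (2 * σ) (by
        have := pow_le_pow_left₀ hη.le (hsep y hy.1 hyδ) 2
        rw [hσ_def]
        nlinarith)
      convert! this using 4
      ring
    have hj0 : 0 ≤ ∫ y in Y \ Metric.ball y₀ δ, jointDensity X M f p lam (f y₀) y :=
      setIntegral_nonneg hms fun y hy => jointDensity_nonneg h hX hp hlam _ hy.1
    rw [integral_const_mul]
    calc _ ≤ lam ^ d * (I * (K * Real.exp (-(σ * lam)))) := by gcongr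
      _ = _ := by
        rw [mul_pow]
        field_simp

end Likelihood

/-! ### Limit of the rescaled joint density -/

section Posterior

variable {d D : ℕ} {X : Set (EuclideanSpace ℝ (Fin D))}
  {M : EuclideanSpace ℝ (Fin D) → Matrix (Fin D) (Fin D) ℝ}
  {Y : Set (EuclideanSpace ℝ (Fin d))}
  {f : EuclideanSpace ℝ (Fin d) → EuclideanSpace ℝ (Fin D)}
  {p : EuclideanSpace ℝ (Fin d) → ℝ} {y₀ : EuclideanSpace ℝ (Fin d)}

/-- The limit of the joint density at scale `lam ^ (-1/2)` around `y₀`, up to normalization. -/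
noncomputable def limitProfile (M : EuclideanSpace ℝ (Fin D) → Matrix (Fin D) (Fin D) ℝ)
    (f : EuclideanSpace ℝ (Fin d) → EuclideanSpace ℝ (Fin D)) (p : EuclideanSpace ℝ (Fin d) → ℝ)
    (y₀ u : EuclideanSpace ℝ (Fin d)) : ℝ :=
  p y₀ / (∫ w, Real.exp (-(1 / 2) * metricSq (M (f y₀)) w)) *
    Real.exp (-(1 / 2) * metricSq (pullbackMetric f M y₀) u)

theorem limitProfile_rescaled {lam : ℝ} (hlam : 0 < lam) (y : EuclideanSpace ℝ (Fin d)) :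
    limitProfile M f p y₀ (√lam • (y - y₀)) =
      p y₀ / (∫ w, Real.exp (-(1 / 2) * metricSq (M (f y₀)) w)) *
        gaussKernel (pullbackMetric f M) lam y₀ y := by
  rw [limitProfile, gaussKernel, metricSq_smul, Real.sq_sqrt hlam.le]
  congr 2
  ring

/-- The powers of `√lam` are chosen so that the ratio factors as `p y / p y₀`, `W / (√lam ^ D *
gaussZ)` and the exponential of `-lam / 2` times the second-order error; each tends to 1. -/
theorem tendsto_jointDensity_div_limitProfile (h : UniformAlong X M Y f) (hX : IsOpen X)
    (hM : IsMetricOn M X) (hY : IsOpen Y) (hf : IsSmoothEmbeddingOn f Y X)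
    (hp_cont : ContinuousOn p Y) (hy₀ : y₀ ∈ Y) (hp_pos : 0 < p y₀) (R : ℝ) :
    Tendsto (fun z : ℝ × EuclideanSpace ℝ (Fin d) =>
        √z.1 ^ d / √z.1 ^ D * jointDensity X M f p z.1 (f y₀) z.2 /
          (√z.1 ^ d * limitProfile M f p y₀ (√z.1 • (z.2 - y₀))))
      (scaleFilter y₀ R) (𝓝 1) := by
  obtain ⟨c, hc, hlow⟩ := h.lower
  set W := ∫ w, Real.exp (-(1 / 2) * metricSq (M (f y₀)) w) with hW
  have hWpos : 0 < W := integral_exp_neg_metricSq_pos hc (hlow y₀ hy₀) one_half_pos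
  have hle : scaleFilter y₀ R ≤ atTop ×ˢ 𝓝 y₀ := inf_le_left
  have h1 : Tendsto (fun z : ℝ × EuclideanSpace ℝ (Fin d) => p z.2) (scaleFilter y₀ R)
      (𝓝 (p y₀)) :=
    ((hp_cont.continuousAt (hY.mem_nhds hy₀)).tendsto.comp tendsto_snd).mono_left hle
  have h2 := (tendsto_sqrt_pow_mul_gaussZ hX hM hY hf hc hlow hy₀).mono_left hle
  have h3 := (Real.continuous_exp.tendsto _).comp ((tendsto_mul_scaleFilter R
    (metricSq_sub_pullbackMetric_isLittleO hM hY hf hy₀)).const_mul (-(1 / 2)))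
  have hlim := ((h1.div_const (p y₀)).mul ((tendsto_const_nhds (x := W)).div h2 hWpos.ne')).mul h3
  rw [mul_zero, Real.exp_zero, div_self hp_pos.ne', div_self hWpos.ne', mul_one, mul_one] at hlim
  refine hlim.congr' ?_
  have hpos : ∀ᶠ z in scaleFilter y₀ R, 0 < z.1 :=
    (tendsto_fst.mono_left hle).eventually (eventually_gt_atTop 0)
  have hYn : ∀ᶠ z in scaleFilter y₀ R, z.2 ∈ Y :=
    (tendsto_snd.mono_left hle).eventually (hY.mem_nhds hy₀)
  filter_upwards [hpos, hYn] with z hz hzY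
  have hs : 0 < √z.1 := Real.sqrt_pos.2 hz
  have hZ := gaussZ_pos_of_uniformAlong h hX hz hzY
  rw [limitProfile_rescaled hz, jointDensity, gaussDensity, ← hW]
  have hexp : Real.exp (-(1 / 2) * (z.1 * (metricSq (M (f z.2)) (f y₀ - f z.2) -
      metricSq (pullbackMetric f M y₀) (z.2 - y₀)))) =
      gaussKernel M z.1 (f z.2) (f y₀) / gaussKernel (pullbackMetric f M) z.1 y₀ z.2 := by
    rw [gaussKernel, gaussKernel, ← Real.exp_sub]
    congr 1
    ring
  have hG := gaussKernel_pos (pullbackMetric f M) z.1 y₀ z.2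
  simp only [Function.comp_apply, Pi.div_apply, hexp]
  field_simp

theorem integrable_limitProfile (h : UniformAlong X M Y f) (hf : IsSmoothEmbeddingOn f Y X)
    (hy₀ : y₀ ∈ Y) : Integrable (limitProfile M f p y₀) := by
  obtain ⟨c, hc, hlow⟩ := h.lower
  obtain ⟨κ, hκ, hpull⟩ := exists_mul_norm_sq_le_pullbackMetric hf hc hlow hy₀
  exact (integrable_exp_neg_metricSq hκ hpull one_half_pos).const_mul _

theorem limitProfile_pos (h : UniformAlong X M Y f) (hy₀ : y₀ ∈ Y) (hp_pos : 0 < p y₀)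
    (u : EuclideanSpace ℝ (Fin d)) : 0 < limitProfile M f p y₀ u := by
  obtain ⟨c, hc, hlow⟩ := h.lower
  exact mul_pos (div_pos hp_pos (integral_exp_neg_metricSq_pos hc (hlow y₀ hy₀) one_half_pos))
    (Real.exp_pos _)

theorem integral_limitProfile_pos (h : UniformAlong X M Y f) (hf : IsSmoothEmbeddingOn f Y X)
    (hy₀ : y₀ ∈ Y) (hp_pos : 0 < p y₀) : 0 < ∫ u, limitProfile M f p y₀ u := by
  obtain ⟨c, hc, hlow⟩ := h.lower
  obtain ⟨κ, hκ, hpull⟩ := exists_mul_norm_sq_le_pullbackMetric hf hc hlow hy₀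
  simp only [limitProfile, integral_const_mul]
  exact mul_pos (div_pos hp_pos (integral_exp_neg_metricSq_pos hc (hlow y₀ hy₀) one_half_pos))
    (integral_exp_neg_metricSq_pos hκ hpull one_half_pos)

/-- A Gaussian bound for the joint density near the preimage of the observation. -/
theorem exists_eventually_jointDensity_le (h : UniformAlong X M Y f) (hX : IsOpen X)
    (hM : IsMetricOn M X) (hY : IsOpen Y) (hf : IsSmoothEmbeddingOn f Y X)
    (hp_cont : ContinuousOn p Y) (hp : ∀ y ∈ Y, 0 ≤ p y) (hy₀ : y₀ ∈ Y) :
    ∃ K κ : ℝ, 0 < κ ∧ ∀ᶠ z : ℝ × EuclideanSpace ℝ (Fin d) in atTop ×ˢ 𝓝 y₀,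
      √z.1 ^ d / √z.1 ^ D * jointDensity X M f p z.1 (f y₀) z.2 ≤
        √z.1 ^ d * (K * Real.exp (-κ * (z.1 * ‖z.2 - y₀‖ ^ 2))) := by
  obtain ⟨c, hc, hlow⟩ := h.lower
  obtain ⟨κ, hκ, hquad⟩ := eventually_mul_norm_sq_le_metricSq hY hf hc hlow hy₀
  set W := ∫ w, Real.exp (-(1 / 2) * metricSq (M (f y₀)) w) with hW
  have hWpos : 0 < W := integral_exp_neg_metricSq_pos hc (hlow y₀ hy₀) one_half_pos
  refine ⟨(p y₀ + 1) / (W / 2), κ / 2, by positivity, ?_⟩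
  have h1 : ∀ᶠ y in 𝓝 y₀, p y < p y₀ + 1 :=
    (hp_cont.continuousAt (hY.mem_nhds hy₀)).eventually (gt_mem_nhds (by linarith))
  have h2 := (tendsto_sqrt_pow_mul_gaussZ hX hM hY hf hc hlow hy₀).eventually
    (lt_mem_nhds (half_lt_self hWpos))
  filter_upwards [(eventually_gt_atTop (0 : ℝ)).prod_mk
    (h1.and (hquad.and (hY.mem_nhds hy₀))), h2] with z ⟨hz, hpz, hqz, hzY⟩ hWz
  have hs : 0 < √z.1 := Real.sqrt_pos.2 hz
  have hZ := gaussZ_pos_of_uniformAlong h hX hz hzY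
  have hpz0 := hp z.2 hzY
  have hp0 := hp y₀ hy₀
  have hk : gaussKernel M z.1 (f z.2) (f y₀) ≤
      Real.exp (-(κ / 2) * (z.1 * ‖z.2 - y₀‖ ^ 2)) := by
    refine Real.exp_le_exp.2 ?_
    nlinarith
  calc √z.1 ^ d / √z.1 ^ D * jointDensity X M f p z.1 (f y₀) z.2
      = √z.1 ^ d * (p z.2 / (√z.1 ^ D * gaussZ X M z.1 (f z.2)) *
          gaussKernel M z.1 (f z.2) (f y₀)) := by
        rw [jointDensity, gaussDensity]
        field_simp
    _ ≤ _ := by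
        gcongr
        exact (gaussKernel_pos _ _ _ _).le

theorem tendsto_integral_abs_jointDensity_sub (h : UniformAlong X M Y f) (hX : IsOpen X)
    (hM : IsMetricOn M X) (hY : IsOpen Y) (hf : IsSmoothEmbeddingOn f Y X)
    (hp_cont : ContinuousOn p Y) (hp : ∀ y ∈ Y, 0 ≤ p y) (hp_int : IntegrableOn p Y)
    (hy₀ : y₀ ∈ Y) (hp_pos : 0 < p y₀) :
    Tendsto (fun lam => ∫ y in Y, |√lam ^ d / √lam ^ D * jointDensity X M f p lam (f y₀) y -
      √lam ^ d * limitProfile M f p y₀ (√lam • (y - y₀))|) atTop (𝓝 0) := by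
  obtain ⟨K, κ, hκ, hbound⟩ := exists_eventually_jointDensity_le h hX hM hY hf hp_cont hp hy₀
  refine tendsto_integral_abs_sub_rescaled hY hy₀
    (a := fun lam y => √lam ^ d / √lam ^ D * jointDensity X M f p lam (f y₀) y) ?_ ?_
    (integrable_limitProfile h hf hy₀) ?_ hκ hbound
    (fun δ hδ => tendsto_setIntegral_jointDensity_diff_ball h hX hM hY hf hp_cont hp hp_int hy₀ hδ)
  · filter_upwards [eventually_gt_atTop 0] with lam hlam
    exact (integrableOn_jointDensity h hX hM hY hf hp_cont hp hp_int hy₀ hlam _).const_mul _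
  · filter_upwards [eventually_gt_atTop 0] with lam hlam y hy
    exact mul_nonneg (by positivity) (jointDensity_nonneg h hX hp hlam _ hy)
  · intro u
    have hpos := limitProfile_pos h hy₀ hp_pos u
    -- The pointwise limit at `u` is the ratio limit along the path `y₀ + (√lam)⁻¹ • u`.
    have := ((tendsto_jointDensity_div_limitProfile h hX hM hY hf hp_cont hy₀ hp_pos ‖u‖).comp
      (tendsto_rescale_scaleFilter y₀ u)).mul_const (limitProfile M f p y₀ u)
    rw [one_mul] at this
    refine this.congr' ?_
    filter_upwards [eventually_gt_atTop 0] with lam hlam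
    have hs : 0 < √lam := Real.sqrt_pos.2 hlam
    simp only [Function.comp_apply, add_sub_cancel_left, smul_inv_smul₀ hs.ne']
    field_simp

theorem posteriorDensity_eq {lam : ℝ} (hlam : 0 < lam) (x : EuclideanSpace ℝ (Fin D))
    (y : EuclideanSpace ℝ (Fin d)) :
    posteriorDensity X M Y f p lam x y = √lam ^ d / √lam ^ D * jointDensity X M f p lam x y /
      ∫ y in Y, √lam ^ d / √lam ^ D * jointDensity X M f p lam x y := by
  have hs : 0 < √lam := Real.sqrt_pos.2 hlam
  rw [integral_const_mul, mul_div_mul_left _ _ (by positivity)]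
  rfl

theorem gaussDensity_pullbackMetric_eq (h : UniformAlong X M Y f) (hy₀ : y₀ ∈ Y)
    (hp_pos : 0 < p y₀) {lam : ℝ} (hlam : 0 < lam) (y : EuclideanSpace ℝ (Fin d)) :
    gaussDensity Y (pullbackMetric f M) lam y₀ y =
      √lam ^ d * limitProfile M f p y₀ (√lam • (y - y₀)) /
        ∫ y in Y, √lam ^ d * limitProfile M f p y₀ (√lam • (y - y₀)) := by
  obtain ⟨c, hc, hlow⟩ := h.lower
  have hW := integral_exp_neg_metricSq_pos hc (hlow y₀ hy₀) one_half_pos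
  have hs : 0 < √lam := Real.sqrt_pos.2 hlam
  simp only [limitProfile_rescaled hlam, integral_const_mul]
  rw [mul_div_mul_left _ _ (by positivity), mul_div_mul_left _ _ (div_pos hp_pos hW).ne']
  rfl

end Posterior

end RiemGauss

/-! ### Convergence of the posterior -/

theorem theorem8 {d D : ℕ}
    (X : Set (EuclideanSpace ℝ (Fin D))) (hX : IsOpen X)
    (M : EuclideanSpace ℝ (Fin D) → Matrix (Fin D) (Fin D) ℝ)
    (hM : RiemGauss.IsMetricOn M X)
    (Y : Set (EuclideanSpace ℝ (Fin d))) (hY : IsOpen Y)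
    (f : EuclideanSpace ℝ (Fin d) → EuclideanSpace ℝ (Fin D))
    (hf : RiemGauss.IsSmoothEmbeddingOn f Y X)
    (hunif : RiemGauss.UniformAlong X M Y f)
    (p : EuclideanSpace ℝ (Fin d) → ℝ)
    (hp_smooth : ContDiffOn ℝ ∞ p Y) (hp_nonneg : ∀ y ∈ Y, 0 ≤ p y)
    (hp_one : ∫ y in Y, p y = 1)
    (x : EuclideanSpace ℝ (Fin D)) (y₀ : EuclideanSpace ℝ (Fin d))
    (hy₀ : y₀ ∈ Y) (hx : f y₀ = x) (hp_pos : 0 < p y₀) :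
    -- the posterior is well defined
    (∀ lam : ℝ, 0 < lam →
      IntegrableOn (RiemGauss.jointDensity X M f p lam x) Y ∧
      0 < RiemGauss.evidence X M Y f p lam x) ∧
    -- convergence of the densities in `L¹(Y)`, i.e. in total variation
    Tendsto (fun lam : ℝ => ∫⁻ y in Y, ENNReal.ofReal
        |RiemGauss.posteriorDensity X M Y f p lam x y -
          RiemGauss.gaussDensity Y (RiemGauss.pullbackMetric f M) lam y₀ y|)
      atTop (𝓝 0) ∧
    -- the ratio of the densities tends to one, uniformly at the scale `lam ^ (-1/2)`
    (∀ R : ℝ, ∀ ε : ℝ, 0 < ε → ∀ᶠ lam : ℝ in atTop,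
      ∀ y ∈ Y, ‖y - y₀‖ ≤ R / Real.sqrt lam →
        |RiemGauss.posteriorDensity X M Y f p lam x y /
          RiemGauss.gaussDensity Y (RiemGauss.pullbackMetric f M) lam y₀ y - 1| < ε) := by
  subst hx
  have hp_cont := hp_smooth.continuousOn
  have hp_int : IntegrableOn p Y :=
    Integrable.of_integral_ne_zero (by rw [hp_one]; exact one_ne_zero)
  have hjoint (lam : ℝ) (hlam : 0 < lam) := RiemGauss.integrableOn_jointDensity hunif hX hM hY hf
    hp_cont hp_nonneg hp_int hy₀ hlam (f y₀)
  have hev (lam : ℝ) (hlam : 0 < lam) := RiemGauss.evidence_pos hunif hX hM hY hf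
    hp_cont hp_nonneg hp_int hy₀ hp_pos hlam (f y₀)
  refine ⟨fun lam hlam => ⟨hjoint lam hlam, hev lam hlam⟩, ?_⟩
  set a : ℝ → EuclideanSpace ℝ (Fin d) → ℝ := fun lam y =>
    √lam ^ d / √lam ^ D * RiemGauss.jointDensity X M f p lam (f y₀) y with ha
  set b : ℝ → EuclideanSpace ℝ (Fin d) → ℝ := fun lam y =>
    √lam ^ d * RiemGauss.limitProfile M f p y₀ (√lam • (y - y₀)) with hb
  set I := ∫ u, RiemGauss.limitProfile M f p y₀ u with hI
  have hIpos : 0 < I := RiemGauss.integral_limitProfile_pos hunif hf hy₀ hp_pos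
  have hβ : Integrable (RiemGauss.limitProfile M f p y₀) :=
    RiemGauss.integrable_limitProfile hunif hf hy₀
  have hpost {lam : ℝ} (hlam : 0 < lam) (y : EuclideanSpace ℝ (Fin d)) :
      RiemGauss.posteriorDensity X M Y f p lam (f y₀) y = a lam y / ∫ y in Y, a lam y :=
    RiemGauss.posteriorDensity_eq hlam _ y
  have hgauss {lam : ℝ} (hlam : 0 < lam) (y : EuclideanSpace ℝ (Fin d)) :
      RiemGauss.gaussDensity Y (RiemGauss.pullbackMetric f M) lam y₀ y =
        b lam y / ∫ y in Y, b lam y :=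
    RiemGauss.gaussDensity_pullbackMetric_eq hunif hy₀ hp_pos hlam y
  have ha_int {lam : ℝ} (hlam : 0 < lam) : IntegrableOn (a lam) Y :=
    (hjoint lam hlam).const_mul _
  have hb_int {lam : ℝ} (hlam : 0 < lam) : IntegrableOn (b lam) Y :=
    (((hβ.comp_smul (Real.sqrt_pos.2 hlam).ne').comp_sub_right y₀).const_mul _).integrableOn
  have hL1 : Tendsto (fun lam => ∫ y in Y, |a lam y - b lam y|) atTop (𝓝 0) :=
    RiemGauss.tendsto_integral_abs_jointDensity_sub hunif hX hM hY hf hp_cont hp_nonneg hp_int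
      hy₀ hp_pos
  have hB : Tendsto (fun lam => ∫ y in Y, b lam y) atTop (𝓝 I) :=
    RiemGauss.tendsto_integral_rescaled hY hy₀ hβ
  -- `L¹` closeness transfers the limit mass from `b` to `a`.
  have hA : Tendsto (fun lam => ∫ y in Y, a lam y) atTop (𝓝 I) := by
    have hdiff : Tendsto (fun lam => ∫ y in Y, (a lam y - b lam y)) atTop (𝓝 0) :=
      squeeze_zero_norm (fun lam => norm_integral_le_integral_norm _) hL1
    have hadd := hdiff.add hB
    rw [zero_add] at hadd
    refine hadd.congr' ?_
    filter_upwards [eventually_gt_atTop 0] with lam hlam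
    rw [integral_sub (ha_int hlam) (hb_int hlam), sub_add_cancel]
  have hApos := hA.eventually (lt_mem_nhds hIpos)
  have hBpos := hB.eventually (lt_mem_nhds hIpos)
  constructor
  · have hlim : Tendsto (fun lam => ENNReal.ofReal (2 * (∫ y in Y, |a lam y - b lam y|) /
        ∫ y in Y, a lam y)) atTop (𝓝 0) := by
      have := ENNReal.tendsto_ofReal ((hL1.const_mul 2).div hA hIpos.ne')
      simpa using this
    refine tendsto_of_tendsto_of_tendsto_of_le_of_le' tendsto_const_nhds hlim
      (Eventually.of_forall fun _ => zero_le) ?_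
    filter_upwards [eventually_gt_atTop 0, hApos, hBpos] with lam hlam hAl hBl
    simp only [hpost hlam, hgauss hlam]
    refine RiemGauss.lintegral_abs_div_integral_sub_le (ha_int hlam) (hb_int hlam)
      (Eventually.of_forall fun y => ?_) hAl hBl
    exact mul_nonneg (by positivity) (RiemGauss.limitProfile_pos hunif hy₀ hp_pos _).le
  · intro R ε hε
    have hfst : Tendsto (Prod.fst : ℝ × EuclideanSpace ℝ (Fin d) → ℝ)
        (RiemGauss.scaleFilter y₀ R) atTop := tendsto_fst.mono_left inf_le_left
    -- The ratio of the normalized densities is `a / b` times the inverse ratio of masses, and both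
    -- factors tend to 1.
    have hratio := (RiemGauss.tendsto_jointDensity_div_limitProfile hunif hX hM hY hf hp_cont hy₀
      hp_pos R).mul ((hB.div hA hIpos.ne').comp hfst)
    rw [div_self hIpos.ne', one_mul] at hratio
    filter_upwards [eventually_gt_atTop 0, RiemGauss.eventually_forall_of_scaleFilter
      (hratio.eventually (Metric.ball_mem_nhds 1 hε))] with lam hlam hl y _ hyR
    have := hl y hyR
    rw [hpost hlam, hgauss hlam, div_div_div_comm, div_div_eq_mul_div, ← mul_div_assoc']
    exact this
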